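/- For $i=1,2$ let $X_i$ be a countable (finite or infinite) set, $m_i\colon X_i\to(0,\infty)$ a measure of full support, and $(b_i,c_i)$ a graph over $X_i$: $b_i\colon X_i\times X_i\to[0,\infty)$ is symmetric, vanishes on the diagonal and satisfies $\sum_{y}b_i(x,y)<\infty$ for all $x\in X_i$, and $c_i\colon X_i\to[0,\infty)$ is arbitrary. For $f\colon X_i\to\mathbb R$ put $$\mathcal Q_i(f)=\tfrac12\sum_{x,y\in X_i}b_i(x,y)|f(x)-f(y)|^2+\sum_{x\in X_i}c_i(x)|f(x)|^2\in[0,\infty],$$ and denote by $\mathcal Q_i(f,g)$ the bilinear form obtained from it by polarization on $\mathcal D_i=\{f:\mathcal Q_i(f)<\infty\}$. Let $Q_i$ be a Dirichlet form associated to $(b_i,c_i)$ over $(X_i,m_i)$, that is, a closed non-negative symmetric form on $\ell^2(X_i,m_i)$ whose domain $D(Q_i)$ contains all finitely supported functions and is contained in $\mathcal D_i\cap\ell^2(X_i,m_i)$, with $Q_i(u,v)=\mathcal Q_i(u,v)$ for $u,v\in D(Q_i)$, and such that $C\circ u\in D(Q_i)$ and $Q_i(C\circ u)\le Q_i(u)$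 for all $u\in D(Q_i)$ and all $C\colon\mathbb R\to\mathbb R$ with $|C(p)|\le|p|$ and $|C(p)-C(q)|\le|p-q|$ for all $p,q\in\mathbb R$. Let $L_i$ be its Laplacian, the self-adjoint operator on $\ell^2(X_i,m_i)$ with $u\in D(L_i)$ and $L_iu=w$ if and only if $u\in D(Q_i)$ and $Q_i(u,v)=\langle w,v\rangle$ for all $v\in D(Q_i)$. Assume that $m_1\equiv1$ and $m_2\equiv1$ and that $(b_1,c_1)$ is connected, that is, any two vertices $x,y\in X_1$ are joined by a finite sequence $x=x_0,\dots,x_n=y$ of pairwise distinct vertices with $b_1(x_{k-1},x_k)>0$ for $k=1,\dots,n$. Let $U\colon\ell^2(X_1,m_1)\to\ell^2(X_2,m_2)$ be an order isomorphism (an invertible linear map such that $U$ and $U^{-1}$ map non-negative functions to non-negative functions) that intertwines $L_1$ and $L_2$, that is, $UD(L_1)=D(L_2)$ and $UL_1f=L_2Uf$ for all $f\in D(L_1)$. Then there are a unique function $h\colon X_2\to(0,\infty)$ and a unique bijection $\tau\colon X_2\to X_1$ such that $Uf=h\cdot(f\circ\tau)$ for all $f\in\ell^2(X_1,m_1)$,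 and the bijection $\tau$ satisfies $$b_1(\tau(y),\tau(z))=b_2(y,z)\quad\text{and}\quad c_1(\tau(y))=c_2(y)\qquad\text{for all }y,z\in X_2.$$ -/

import Mathlib

namespace GraphDiffusion

/-- A weighted graph `(b, c)` over a vertex set `X`: a symmetric edge weight `b ≥ 0` with zero
diagonal and summable rows, and a killing term `c ≥ 0`. -/
structure WeightedGraph (X : Type*) where
  b : X → X → ℝ
  c : X → ℝ
  b_nonneg : ∀ x y, 0 ≤ b x y
  b_symm : ∀ x y, b x y = b y x
  b_diag : ∀ x, b x x = 0
  b_summable : ∀ x, Summable (fun y => b x y)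
  c_nonneg : ∀ x, 0 ≤ c x

/-- Any two vertices are joined by a path, i.e. by a finite sequence of pairwise distinct
vertices in which consecutive vertices are joined by an edge of positive weight. -/
def WeightedGraph.Connected {X : Type*} (G : WeightedGraph X) : Prop :=
  ∀ x y : X, ∃ (n : ℕ) (p : Fin (n + 1) → X), Function.Injective p ∧
    p 0 = x ∧ p (Fin.last n) = y ∧ ∀ i : Fin n, 0 < G.b (p i.castSucc) (p i.succ)

/-- The generalized form `f ↦ ½ ∑ b(x,y) |f(x) - f(y)|² + ∑ c(x) |f(x)|²` with values in
`[0, ∞]`. -/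
noncomputable def WeightedGraph.energy {X : Type*} (G : WeightedGraph X) (f : X → ℝ) : ENNReal :=
  (∑' p : X × X, ENNReal.ofReal (G.b p.1 p.2 * (f p.1 - f p.2) ^ 2)) / 2 +
    ∑' x, ENNReal.ofReal (G.c x * f x ^ 2)

/-- The polarized generalized form; the sums converge absolutely when `f` and `g` both have
finite energy. -/
noncomputable def WeightedGraph.energyBilin {X : Type*} (G : WeightedGraph X) (f g : X → ℝ) : ℝ :=
  (1 / 2) * (∑' p : X × X, G.b p.1 p.2 * (f p.1 - f p.2) * (g p.1 - g p.2)) +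
    ∑' x, G.c x * f x * g x

/-- The space `ℓ²(X, m)` of real functions that are square summable with respect to the
point masses `m x`. -/
def ell2 {X : Type*} (m : X → ℝ) : Submodule ℝ (X → ℝ) where
  carrier := {f | Summable fun x => f x ^ 2 * m x}
  zero_mem' := by simp [summable_zero]
  add_mem' := by
    intro f g hf hg
    have hf' : Summable fun x => ‖f x ^ 2 * m x‖ := Summable.norm hf
    have hg' : Summable fun x => ‖g x ^ 2 * m x‖ := Summable.norm hg
    refine Summable.of_norm_bounded ((hf'.add hg').mul_left 2) ?_
    intro x
    simp only [Pi.add_apply, norm_mul, Real.norm_eq_abs, abs_pow, sq_abs]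
    nlinarith [mul_nonneg (sq_nonneg (f x - g x)) (abs_nonneg (m x))]
  smul_mem' := by
    intro a f hf
    have h : Summable fun x => a ^ 2 * (f x ^ 2 * m x) := Summable.mul_left (a ^ 2) hf
    refine h.congr ?_
    intro x
    simp only [Pi.smul_apply, smul_eq_mul]
    ring

/-- The scalar product of `ℓ²(X, m)`. -/
noncomputable def ell2Inner {X : Type*} {m : X → ℝ} (f g : ell2 m) : ℝ :=
  ∑' x, f.1 x * g.1 x * m x

/-- A densely or non-densely defined non-negative symmetric form on `ℓ²(X, m)`. -/
structure NonnegForm {X : Type*} (m : X → ℝ) where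
  domain : Submodule ℝ (ell2 m)
  form : domain →ₗ[ℝ] domain →ₗ[ℝ] ℝ
  symm : ∀ u v, form u v = form v u
  nonneg : ∀ u, 0 ≤ form u u

/-- The square of the form norm, `Q(u) + ‖u‖²`. -/
noncomputable def NonnegForm.normSq {X : Type*} {m : X → ℝ} (Q : NonnegForm m) (u : Q.domain) :
    ℝ :=
  Q.form u u + ell2Inner u.1 u.1

/-- The form is closed: its domain is complete with respect to the form norm. -/
def NonnegForm.Closed {X : Type*} {m : X → ℝ} (Q : NonnegForm m) : Prop :=
  ∀ u : ℕ → Q.domain,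
    (∀ ε : ℝ, 0 < ε → ∃ N : ℕ, ∀ i j : ℕ, N ≤ i → N ≤ j → Q.normSq (u i - u j) < ε) →
    ∃ v : Q.domain, Filter.Tendsto (fun n => Q.normSq (u n - v)) Filter.atTop (nhds 0)

/-- `Q` is a form associated to the graph `G` over `(X, m)`: it is closed, its domain lies between
the finitely supported functions and the functions of finite energy in `ℓ²(X, m)`, and it
is a restriction of the generalized form of `G`. -/
structure NonnegForm.AssociatedTo {X : Type*} {m : X → ℝ} (Q : NonnegForm m)
    (G : WeightedGraph X) : Prop where
  closed : Q.Closed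
  finite_support_mem : ∀ f : ell2 m, (Function.support f.1).Finite → f ∈ Q.domain
  energy_lt_top : ∀ u : Q.domain, G.energy u.1.1 < ⊤
  form_eq : ∀ u v : Q.domain, Q.form u v = G.energyBilin u.1.1 v.1.1

/-- A normal contraction of the real line. -/
def IsNormalContraction (C : ℝ → ℝ) : Prop :=
  (∀ p, |C p| ≤ |p|) ∧ ∀ p q, |C p - C q| ≤ |p - q|

/-- `Q` is a Dirichlet form associated to `G`: moreover, normal contractions operate on `Q`.
(With the convention `Q(f) = ∞` off the domain, `Q(C f) ≤ Q(f)` includes that `C f` is in the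
domain.) -/
structure NonnegForm.DirichletAssociatedTo {X : Type*} {m : X → ℝ} (Q : NonnegForm m)
    (G : WeightedGraph X) : Prop extends Q.AssociatedTo G where
  contraction : ∀ C : ℝ → ℝ, IsNormalContraction C → ∀ u : Q.domain,
    ∃ v : Q.domain, v.1.1 = C ∘ u.1.1 ∧ Q.form v v ≤ Q.form u u

theorem ell2_summable_mul {X : Type*} {m : X → ℝ} (f g : ell2 m) :
    Summable fun x => f.1 x * g.1 x * m x := by
  have hf' : Summable fun x => ‖f.1 x ^ 2 * m x‖ := Summable.norm f.2
  have hg' : Summable fun x => ‖g.1 x ^ 2 * m x‖ := Summable.norm g.2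
  refine Summable.of_norm_bounded (hf'.add hg') ?_
  intro x
  simp only [norm_mul, Real.norm_eq_abs, abs_pow]
  nlinarith [mul_nonneg (sq_nonneg (|f.1 x| - |g.1 x|)) (abs_nonneg (m x)),
    mul_nonneg (sq_nonneg (|f.1 x| + |g.1 x|)) (abs_nonneg (m x))]

theorem ell2Inner_add_left {X : Type*} {m : X → ℝ} (f g k : ell2 m) :
    ell2Inner (f + g) k = ell2Inner f k + ell2Inner g k := by
  unfold ell2Inner
  rw [← (ell2_summable_mul f k).tsum_add (ell2_summable_mul g k)]
  refine tsum_congr fun x => ?_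
  simp only [Submodule.coe_add, Pi.add_apply]
  ring

theorem ell2Inner_smul_left {X : Type*} {m : X → ℝ} (a : ℝ) (f k : ell2 m) :
    ell2Inner (a • f) k = a * ell2Inner f k := by
  unfold ell2Inner
  rw [← tsum_mul_left]
  refine tsum_congr fun x => ?_
  simp only [Submodule.coe_smul, Pi.smul_apply, smul_eq_mul]
  ring

/-- The graph of the generator of `Q`: all pairs `(u, w)` with `u ∈ D(Q)` and
`Q(u, v) = ⟨w, v⟩` for all `v ∈ D(Q)`. -/
def NonnegForm.generatorGraph {X : Type*} {m : X → ℝ} (Q : NonnegForm m) :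
    Submodule ℝ (ell2 m × ell2 m) where
  carrier := {p | ∃ u : Q.domain, u.1 = p.1 ∧ ∀ v : Q.domain, Q.form u v = ell2Inner p.2 v.1}
  zero_mem' := ⟨0, rfl, fun v => by simp [ell2Inner]⟩
  add_mem' := by
    rintro p q ⟨u, hu, hu'⟩ ⟨w, hw, hw'⟩
    refine ⟨u + w, by simp [hu, hw], fun v => ?_⟩
    rw [map_add, LinearMap.add_apply, hu', hw', Prod.snd_add, ell2Inner_add_left]
  smul_mem' := by
    rintro a p ⟨u, hu, hu'⟩
    refine ⟨a • u, by simp [hu], fun v => ?_⟩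
    rw [map_smul, LinearMap.smul_apply, hu', Prod.smul_snd, ell2Inner_smul_left, smul_eq_mul]

/-- The generator (Laplacian) `L` of `Q`, as an unbounded operator in `ℓ²(X, m)`:
`u ∈ D(L)` and `L u = w` if and only if `u ∈ D(Q)` and `Q(u, v) = ⟨w, v⟩` for all `v ∈ D(Q)`. -/
noncomputable def NonnegForm.laplacian {X : Type*} {m : X → ℝ} (Q : NonnegForm m) :
    ell2 m →ₗ.[ℝ] ell2 m :=
  Q.generatorGraph.toLinearPMap

/-- For a form associated to a graph over a measure of full support, the relation that defines the
generator is single-valued, so it is the graph of the Laplacian. -/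
theorem NonnegForm.AssociatedTo.laplacian_graph {X : Type*} {m : X → ℝ} {Q : NonnegForm m}
    {G : WeightedGraph X} (hQ : Q.AssociatedTo G) (hm : ∀ x, 0 < m x) :
    Q.laplacian.graph = Q.generatorGraph := by
  classical
  refine Submodule.toLinearPMap_graph_eq _ ?_
  rintro ⟨p, w⟩ ⟨u, hu, hu'⟩ hp
  have hp0 : p = 0 := hp
  subst hp0
  have hu0 : u = 0 := Subtype.ext hu
  subst hu0
  refine Subtype.ext (funext fun x => ?_)
  have hfin : (Function.support (Pi.single x (1 : ℝ) : X → ℝ)).Finite :=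
    (Set.finite_singleton x).subset (Pi.support_single_subset)
  have hmem : (Pi.single x (1 : ℝ) : X → ℝ) ∈ ell2 m := by
    refine summable_of_hasFiniteSupport (hfin.subset ?_)
    intro y hy hy'
    simp only [Function.mem_support] at hy
    exact hy (by rw [hy']; ring)
  have h := hu' ⟨⟨_, hmem⟩, hQ.finite_support_mem ⟨_, hmem⟩ hfin⟩
  rw [map_zero, LinearMap.zero_apply] at h
  unfold ell2Inner at h
  rw [tsum_eq_single x] at h
  · simp only [Pi.single_eq_same, mul_one] at h
    rcases mul_eq_zero.1 h.symm with h | h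
    · simpa using h
    · exact absurd h (hm x).ne'
  · intro y hy
    simp [Pi.single_eq_of_ne hy]

/-- An order isomorphism between `ℓ²` spaces: an invertible linear map such that it and its inverse
map non-negative functions to non-negative functions. -/
def IsOrderIsomorphism {X₁ X₂ : Type*} {m₁ : X₁ → ℝ} {m₂ : X₂ → ℝ}
    (U : ell2 m₁ ≃ₗ[ℝ] ell2 m₂) : Prop :=
  (∀ f : ell2 m₁, (∀ x, 0 ≤ f.1 x) → ∀ y, 0 ≤ (U f).1 y) ∧
    ∀ g : ell2 m₂, (∀ y, 0 ≤ g.1 y) → ∀ x, 0 ≤ (U.symm g).1 x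

/-- `U` intertwines the operators `L₁` and `L₂`: `U D(L₁) = D(L₂)` and `U L₁ f = L₂ U f` for all
`f ∈ D(L₁)`. -/
def Intertwines {X₁ X₂ : Type*} {m₁ : X₁ → ℝ} {m₂ : X₂ → ℝ}
    (U : ell2 m₁ ≃ₗ[ℝ] ell2 m₂) (L₁ : ell2 m₁ →ₗ.[ℝ] ell2 m₁)
    (L₂ : ell2 m₂ →ₗ.[ℝ] ell2 m₂) : Prop :=
  (⇑U) '' (L₁.domain : Set (ell2 m₁)) = (L₂.domain : Set (ell2 m₂)) ∧
    ∀ (f : L₁.domain) (g : L₂.domain), g.1 = U f.1 → U (L₁ f) = L₂ g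

/-- `h : X₂ → (0, ∞)` and the bijection `τ : X₂ → X₁` are the scaling and the bijection of `U`:
`U f = h · (f ∘ τ)` for all `f`. -/
structure IsScalingAndBijection {X₁ X₂ : Type*} {m₁ : X₁ → ℝ} {m₂ : X₂ → ℝ}
    (U : ell2 m₁ ≃ₗ[ℝ] ell2 m₂) (h : X₂ → ℝ) (τ : X₂ → X₁) : Prop where
  pos : ∀ y, 0 < h y
  bijective : Function.Bijective τ
  apply_eq : ∀ (f : ell2 m₁) (y : X₂), (U f).1 y = h y * f.1 (τ y)

end GraphDiffusion

/-! ### Hilbert space theory of closed forms -/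

namespace GraphDiffusion

open Filter Topology

/-! An order isomorphism maps atoms to atoms, so it has the form `U f = h · (f ∘ τ)`
(`IsOrderIsomorphism.exists_isScalingAndBijection`). The crux is that `h` is constant.

Since `U` intertwines the Laplacians, it intertwines the resolvents `(1 + L)⁻¹`. Both resolvent
kernels are symmetric, because `m₁ ≡ m₂ ≡ 1`. Writing `r` for the first kernel, comparison gives
`h(y)² r(τ y, τ z) = h(z)² r(τ y, τ z)`. The kernel is positive along edges
(`resolvent_single_pos`), so `h` agrees at `y` and `z` whenever `τ y` and `τ z` are adjacent, and
connectedness makes it constant.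

Hence `U` is a multiple of a unitary. As the domain of a generator is a form core, `U` preserves the
forms up to the factor `h²` (`Intertwines.shifted_eq`). On indicators of vertices the factor
cancels, and the form values there are `-b(x, y)` off the diagonal and `∑ b(x, ·) + c(x)` on it,
which recovers the graph. -/

/-- A complete positive definite symmetric bilinear form makes a real vector space a Hilbert
space. -/
theorem exists_hilbert_model.{u} {V : Type u} [AddCommGroup V] [Module ℝ V] (E : V →ₗ[ℝ] V →ₗ[ℝ] ℝ)
    (hsymm : ∀ u v, E u v = E v u) (hnonneg : ∀ u, 0 ≤ E u u) (hdef : ∀ u, E u u = 0 → u = 0)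
    (hcomplete : ∀ u : ℕ → V,
      (∀ ε : ℝ, 0 < ε → ∃ N : ℕ, ∀ i j : ℕ, N ≤ i → N ≤ j → E (u i - u j) (u i - u j) < ε) →
      ∃ v : V, Tendsto (fun n => E (u n - v) (u n - v)) atTop (𝓝 0)) :
    ∃ (H : Type u) (_ : NormedAddCommGroup H) (_ : InnerProductSpace ℝ H) (_ : CompleteSpace H)
      (φ : V ≃ₗ[ℝ] H), ∀ u v, inner ℝ (φ u) (φ v) = E u v := by
  let core : InnerProductSpace.Core ℝ V :=
    { inner := fun u v => E u v
      conj_inner_symm := fun u v => by simpa using hsymm v u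
      re_inner_nonneg := fun u => by simpa using hnonneg u
      add_left := fun u v w => by simp
      smul_left := fun u v r => by simp
      definite := hdef }
  let _ : NormedAddCommGroup V := core.toNormedAddCommGroup
  let _ : InnerProductSpace ℝ V := InnerProductSpace.ofCore core.toCore
  have hnorm : ∀ u : V, ‖u‖ ^ 2 = E u u := fun u => (real_inner_self_eq_norm_sq u).symm
  refine ⟨V, inferInstance, inferInstance, ?_, LinearEquiv.refl ℝ V, fun u v => rfl⟩
  refine Metric.complete_of_cauchySeq_tendsto fun u hu => ?_
  obtain ⟨v, hv⟩ := hcomplete u fun ε hε => by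
    obtain ⟨N, hN⟩ := Metric.cauchySeq_iff.1 hu (√ε) (Real.sqrt_pos.2 hε)
    refine ⟨N, fun i j hi hj => ?_⟩
    have h := hN i hi j hj
    rw [dist_eq_norm] at h
    rw [← hnorm]
    exact (Real.lt_sqrt (norm_nonneg _)).1 h
  refine ⟨v, tendsto_iff_norm_sub_tendsto_zero.2 ?_⟩
  have h := hv.sqrt
  rw [Real.sqrt_zero] at h
  refine h.congr fun n => ?_
  rw [← hnorm, Real.sqrt_sq (norm_nonneg _)]

theorem ell2Inner_comm {X : Type*} {m : X → ℝ} (f g : ell2 m) : ell2Inner f g = ell2Inner g f :=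
  tsum_congr fun x => by ring

/-- The scalar product of `ℓ²(X, m)` as a bilinear map. -/
noncomputable def ell2Bilin {X : Type*} (m : X → ℝ) : ell2 m →ₗ[ℝ] ell2 m →ₗ[ℝ] ℝ :=
  LinearMap.mk₂ ℝ ell2Inner ell2Inner_add_left ell2Inner_smul_left
    (fun f g k => by
      rw [ell2Inner_comm, ell2Inner_add_left, ell2Inner_comm g, ell2Inner_comm k])
    (fun a f g => by rw [ell2Inner_comm, ell2Inner_smul_left, ell2Inner_comm g, smul_eq_mul])

@[simp]
theorem ell2Bilin_apply {X : Type*} {m : X → ℝ} (f g : ell2 m) :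
    ell2Bilin m f g = ell2Inner f g := rfl

theorem ell2Inner_self_nonneg {X : Type*} {m : X → ℝ} (hm : ∀ x, 0 < m x) (f : ell2 m) :
    0 ≤ ell2Inner f f :=
  tsum_nonneg fun x => mul_nonneg (mul_self_nonneg _) (hm x).le

theorem eq_zero_of_ell2Inner_self {X : Type*} {m : X → ℝ} (hm : ∀ x, 0 < m x) (f : ell2 m)
    (h : ell2Inner f f = 0) : f = 0 := by
  have h0 := ((ell2_summable_mul f f).hasSum_iff.2 h)
  rw [hasSum_zero_iff_of_nonneg fun x => mul_nonneg (mul_self_nonneg _) (hm x).le] at h0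
  refine Subtype.ext (funext fun x => ?_)
  have hx := congrFun h0 x
  simpa [(hm x).ne'] using hx

/-- The form `Q(u, v) + ⟨u, v⟩`. -/
noncomputable def NonnegForm.shifted {X : Type*} {m : X → ℝ} (Q : NonnegForm m) :
    Q.domain →ₗ[ℝ] Q.domain →ₗ[ℝ] ℝ :=
  Q.form + (ell2Bilin m).compl₁₂ Q.domain.subtype Q.domain.subtype

namespace NonnegForm

variable {X : Type*} {m : X → ℝ} (Q : NonnegForm m)

theorem shifted_apply (u v : Q.domain) : Q.shifted u v = Q.form u v + ell2Inner u.1 v.1 := rfl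

theorem shifted_comm (u v : Q.domain) : Q.shifted u v = Q.shifted v u := by
  rw [shifted_apply, shifted_apply, Q.symm, ell2Inner_comm]

theorem shifted_nonneg (hm : ∀ x, 0 < m x) (u : Q.domain) : 0 ≤ Q.shifted u u :=
  add_nonneg (Q.nonneg u) (ell2Inner_self_nonneg hm _)

theorem eq_zero_of_shifted_self (hm : ∀ x, 0 < m x) (u : Q.domain) (h : Q.shifted u u = 0) :
    u = 0 := by
  rw [shifted_apply] at h
  refine Subtype.ext (eq_zero_of_ell2Inner_self hm _ ?_)
  linarith [Q.nonneg u, ell2Inner_self_nonneg hm u.1]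

theorem shifted_sub_self (u v : Q.domain) :
    Q.shifted (u - v) (u - v) = Q.shifted u u - 2 * Q.shifted v u + Q.shifted v v := by
  rw [map_sub (Q.shifted (u - v)) u v, Q.shifted_comm (u - v) u, Q.shifted_comm (u - v) v,
    map_sub (Q.shifted u) u v, map_sub (Q.shifted v) u v, Q.shifted_comm u v]
  ring

variable {Q}

/-- The form norm lives on an abstract copy `H` because `Q.domain` already inherits the product
topology of `X → ℝ` as an instance. -/
theorem Closed.exists_hilbert_model.{u} {X : Type u} {m : X → ℝ} {Q : NonnegForm m} (hQ : Q.Closed)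
    (hm : ∀ x, 0 < m x) :
    ∃ (H : Type u) (_ : NormedAddCommGroup H) (_ : InnerProductSpace ℝ H) (_ : CompleteSpace H)
      (φ : Q.domain ≃ₗ[ℝ] H), ∀ u v, inner ℝ (φ u) (φ v) = Q.shifted u v := by
  refine GraphDiffusion.exists_hilbert_model (V := Q.domain) Q.shifted Q.shifted_comm ?_ ?_ ?_
  · exact Q.shifted_nonneg hm
  · exact Q.eq_zero_of_shifted_self hm
  · exact hQ

/-- `1 + L` is surjective. -/
theorem Closed.exists_resolvent (hQ : Q.Closed) (hm : ∀ x, 0 < m x) (w : ell2 m) :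
    ∃ u : Q.domain, ∀ v : Q.domain, Q.shifted u v = ell2Inner w v.1 := by
  obtain ⟨H, _, _, _, φ, hφ⟩ := hQ.exists_hilbert_model hm
  -- By Cauchy–Schwarz, `v ↦ ⟨w, v⟩` is bounded in the form norm; the Riesz representative of this
  -- functional is the solution.
  have hbound : ∀ v : Q.domain, ell2Inner w v.1 ^ 2 ≤ ell2Inner w w * Q.shifted v v := by
    intro v
    have h := LinearMap.BilinForm.apply_sq_le_of_symm (ell2Bilin m)
      (fun f => ell2Inner_self_nonneg hm f) ⟨fun f g => ell2Inner_comm f g⟩ w v.1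
    refine h.trans (mul_le_mul_of_nonneg_left ?_ (ell2Inner_self_nonneg hm w))
    exact le_add_of_nonneg_left (Q.nonneg v)
  let ℓ : H →L[ℝ] ℝ := LinearMap.mkContinuous
    ((ell2Bilin m w) ∘ₗ Q.domain.subtype ∘ₗ φ.symm.toLinearMap) (√(ell2Inner w w)) fun x => by
      have h := hbound (φ.symm x)
      rw [← hφ, φ.apply_symm_apply, real_inner_self_eq_norm_sq] at h
      rw [Real.norm_eq_abs, ← Real.sqrt_sq (norm_nonneg x),
        ← Real.sqrt_mul (ell2Inner_self_nonneg hm w)]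
      exact Real.abs_le_sqrt h
  refine ⟨φ.symm ((InnerProductSpace.toDual ℝ H).symm ℓ), fun v => ?_⟩
  rw [← hφ, φ.apply_symm_apply, InnerProductSpace.toDual_symm_apply]
  simp [ℓ]

/-- The domain of the generator is a form core. -/
theorem Closed.exists_resolvent_approx (hQ : Q.Closed) (hm : ∀ x, 0 < m x) (f : Q.domain)
    {ε : ℝ} (hε : 0 < ε) :
    ∃ (u : Q.domain) (w : ell2 m), (∀ v : Q.domain, Q.shifted u v = ell2Inner w v.1) ∧
      Q.shifted (f - u) (f - u) < ε := by
  obtain ⟨H, _, _, _, φ, hφ⟩ := hQ.exists_hilbert_model hm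
  let K : Submodule ℝ H :=
    { carrier := {x | ∃ w : ell2 m, ∀ v : Q.domain, Q.shifted (φ.symm x) v = ell2Inner w v.1}
      zero_mem' := ⟨0, fun v => by simp [ell2Inner]⟩
      add_mem' := by
        rintro x y ⟨w, hw⟩ ⟨z, hz⟩
        refine ⟨w + z, fun v => ?_⟩
        rw [map_add, map_add, LinearMap.add_apply, hw, hz, ell2Inner_add_left]
      smul_mem' := by
        rintro a x ⟨w, hw⟩
        refine ⟨a • w, fun v => ?_⟩
        rw [map_smul, map_smul, LinearMap.smul_apply, hw, ell2Inner_smul_left, smul_eq_mul] }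
  have hK : K.topologicalClosure = ⊤ := by
    rw [Submodule.topologicalClosure_eq_top_iff, Submodule.eq_bot_iff]
    intro x hx
    -- Testing a vector orthogonal to `K` against its own resolvent gives its squared `ℓ²` norm,
    -- which therefore vanishes.
    obtain ⟨u, hu⟩ := hQ.exists_resolvent hm (φ.symm x).1
    have h := (K.mem_orthogonal x).1 hx (φ u) ⟨(φ.symm x).1, by simpa using hu⟩
    rw [← φ.apply_symm_apply x, hφ, hu] at h
    have h0 : φ.symm x = 0 := Subtype.ext (eq_zero_of_ell2Inner_self hm _ h)
    simpa using h0
  have hmem : φ f ∈ closure (K : Set H) := by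
    rw [← Submodule.topologicalClosure_coe, hK]
    trivial
  obtain ⟨x, ⟨w, hw⟩, hx⟩ := Metric.mem_closure_iff.1 hmem (√ε) (Real.sqrt_pos.2 hε)
  refine ⟨φ.symm x, w, hw, ?_⟩
  rw [← hφ, map_sub φ f (φ.symm x), φ.apply_symm_apply, real_inner_self_eq_norm_sq]
  rw [dist_eq_norm] at hx
  exact (Real.lt_sqrt (norm_nonneg _)).1 hx

theorem mem_generatorGraph_iff {u w : ell2 m} :
    (u, w) ∈ Q.generatorGraph ↔
      ∃ u' : Q.domain, u'.1 = u ∧ ∀ v : Q.domain, Q.shifted u' v = ell2Inner (w + u) v.1 := by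
  refine exists_congr fun u' => and_congr_right ?_
  rintro rfl
  refine forall_congr' fun v => ?_
  rw [shifted_apply, ell2Inner_add_left, add_left_inj]

end NonnegForm

end GraphDiffusion
-- Indicators of vertices and positivity of the resolvent
namespace GraphDiffusion

section Single

variable {X : Type*}

open Classical in
/-- The indicator function of a vertex. -/
noncomputable def ell2Single (m : X → ℝ) (x : X) : ell2 m :=
  ⟨Pi.single x 1, by
    refine summable_of_hasFiniteSupport ((Set.finite_singleton x).subset fun y hy => ?_)
    by_contra h
    exact hy (by simp [Pi.single_eq_of_ne h])⟩

@[simp]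
theorem ell2Single_self (m : X → ℝ) (x : X) : (ell2Single m x).1 x = 1 := by
  simp [ell2Single]

theorem ell2Single_of_ne (m : X → ℝ) {x y : X} (h : y ≠ x) : (ell2Single m x).1 y = 0 := by
  simp [ell2Single, h]

theorem ell2Single_nonneg (m : X → ℝ) (x y : X) : 0 ≤ (ell2Single m x).1 y := by
  by_cases h : y = x
  · simp [h]
  · simp [ell2Single_of_ne m h]

theorem ell2Single_finite_support (m : X → ℝ) (x : X) :
    (Function.support (ell2Single m x).1).Finite :=
  (Set.finite_singleton x).subset fun _ hy => by
    by_contra h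
    exact hy (ell2Single_of_ne m h)

theorem ell2Inner_single {m : X → ℝ} (f : ell2 m) (x : X) :
    ell2Inner f (ell2Single m x) = f.1 x * m x := by
  unfold ell2Inner
  rw [tsum_eq_single x fun y hy => by rw [ell2Single_of_ne m hy]; ring, ell2Single_self, mul_one]

end Single

namespace WeightedGraph

variable {X : Type*} (G : WeightedGraph X)

/-- For counting measure, `ℓ²` functions are bounded, and the rows of `b` are summable. -/
theorem summable_mul_sub {m : X → ℝ} (hm : ∀ x, m x = 1) (f : ell2 m) (x : X) :
    Summable fun z => G.b x z * (f.1 x - f.1 z) := by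
  have hf : Summable fun z => f.1 z ^ 2 := by
    have h : Summable fun z => f.1 z ^ 2 * m z := f.2
    simpa [hm] using h
  refine Summable.of_norm_bounded
    ((G.b_summable x).mul_right (|f.1 x| + √(∑' z, f.1 z ^ 2))) fun z => ?_
  rw [norm_mul, Real.norm_of_nonneg (G.b_nonneg x z)]
  refine mul_le_mul_of_nonneg_left ((abs_sub _ _).trans ?_) (G.b_nonneg x z)
  exact add_le_add le_rfl (Real.abs_le_sqrt (hf.le_tsum z fun y _ => sq_nonneg _))

/-- Green's formula against an indicator: splitting `g p.1 - g p.2` gives two sums that the symmetry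
of `b` identifies, which absorbs the factor `1 / 2`. -/
theorem energyBilin_single (m : X → ℝ) (f : X → ℝ) (x : X)
    (hf : Summable fun z => G.b x z * (f x - f z)) :
    G.energyBilin f (ell2Single m x).1 = ∑' z, G.b x z * (f x - f z) + G.c x * f x := by
  set g := (ell2Single m x).1 with hg
  have hgx : g x = 1 := ell2Single_self m x
  have hgne : ∀ {y}, y ≠ x → g y = 0 := fun h => ell2Single_of_ne m h
  have hleft : HasSum (fun p : X × X => G.b p.1 p.2 * (f p.1 - f p.2) * g p.1)
      (∑' z, G.b x z * (f x - f z)) := by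
    refine ((Prod.mk_right_injective x).hasSum_iff ?_).1 ?_
    · rintro ⟨y, z⟩ h
      have hy : y ≠ x := fun h' => h ⟨z, by rw [h']⟩
      simp [hgne hy]
    · simpa [Function.comp_def, hgx] using hf.hasSum
  have hright : HasSum (fun p : X × X => G.b p.1 p.2 * (f p.1 - f p.2) * -g p.2)
      (∑' z, G.b x z * (f x - f z)) := by
    refine ((Equiv.prodComm X X).hasSum_iff.2 hleft).congr_fun ?_
    rintro ⟨y, z⟩
    simp only [Function.comp, Equiv.prodComm_apply, Prod.swap, G.b_symm z y]
    ring
  have hsum : ∑' p : X × X, G.b p.1 p.2 * (f p.1 - f p.2) * (g p.1 - g p.2) =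
      ∑' z, G.b x z * (f x - f z) + ∑' z, G.b x z * (f x - f z) := by
    rw [← (hleft.add hright).tsum_eq]
    exact tsum_congr fun p => by ring
  have hkill : ∑' y, G.c y * f y * g y = G.c x * f x := by
    rw [tsum_eq_single x fun y hy => by rw [hgne hy, mul_zero], hgx, mul_one]
  rw [energyBilin, hsum, hkill]
  ring

end WeightedGraph

namespace NonnegForm

variable {X : Type*} {m : X → ℝ} {Q : NonnegForm m}

/-- `u = (1 + L)⁻¹ w` for the generator `L` of `Q`, in weak form. -/
def IsResolvent (Q : NonnegForm m) (u : Q.domain) (w : ell2 m) : Prop :=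
  ∀ v : Q.domain, Q.shifted u v = ell2Inner w v.1

theorem IsResolvent.inner_comm {u u' : Q.domain} {w w' : ell2 m} (h : Q.IsResolvent u w)
    (h' : Q.IsResolvent u' w') : ell2Inner w u'.1 = ell2Inner w' u.1 := by
  rw [← h u', ← h' u, Q.shifted_comm]

variable {G : WeightedGraph X}

/-- The resolvent `u` is the unique minimiser of `Q(v) + ‖v‖² - 2⟨w, v⟩`, and for `w ≥ 0` the
function `|u|` does at least as well, so `|u| = u`. -/
theorem DirichletAssociatedTo.resolvent_nonneg (hQ : Q.DirichletAssociatedTo G)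
    (hm : ∀ x, 0 < m x) {u : Q.domain} {w : ell2 m} (h : Q.IsResolvent u w)
    (hw : ∀ x, 0 ≤ w.1 x) (x : X) : 0 ≤ u.1.1 x := by
  obtain ⟨v, hv, hvu⟩ := hQ.contraction (fun p => |p|)
    ⟨fun p => (abs_abs p).le, fun p q => abs_abs_sub_abs_le p q⟩ u
  have hvx : ∀ y, v.1.1 y = |u.1.1 y| := fun y => congrFun hv y
  have hinner : ell2Inner v.1 v.1 = ell2Inner u.1 u.1 :=
    tsum_congr fun y => by rw [hvx, abs_mul_abs_self]
  have hle : ell2Inner w u.1 ≤ ell2Inner w v.1 := by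
    refine (ell2_summable_mul w u.1).tsum_le_tsum (fun y => ?_) (ell2_summable_mul w v.1)
    rw [hvx]
    exact mul_le_mul_of_nonneg_right
      (mul_le_mul_of_nonneg_left (le_abs_self _) (hw y)) (hm y).le
  have hsub := Q.shifted_sub_self v u
  have hpos := Q.shifted_nonneg hm (v - u)
  have hzero : Q.shifted (v - u) (v - u) = 0 := by
    rw [h v, h u, Q.shifted_apply v v, hinner] at hsub
    have huu := h u
    rw [Q.shifted_apply] at huu
    linarith
  have hvu : v = u := sub_eq_zero.1 (Q.eq_zero_of_shifted_self hm _ hzero)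
  rw [← hvu, hvx]
  exact abs_nonneg _

/-- The indicator function of a vertex as an element of the form domain. -/
noncomputable def AssociatedTo.single (hQ : Q.AssociatedTo G) (x : X) : Q.domain :=
  ⟨ell2Single m x, hQ.finite_support_mem _ (ell2Single_finite_support m x)⟩

theorem AssociatedTo.form_single (hQ : Q.AssociatedTo G) (hm : ∀ x, m x = 1) (u : Q.domain)
    (x : X) : Q.form u (hQ.single x) =
      ∑' z, G.b x z * (u.1.1 x - u.1.1 z) + G.c x * u.1.1 x := by
  rw [hQ.form_eq]
  exact G.energyBilin_single m _ x (G.summable_mul_sub hm u.1 x)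

theorem AssociatedTo.form_single_of_ne (hQ : Q.AssociatedTo G) (hm : ∀ x, m x = 1) {x y : X}
    (h : x ≠ y) : Q.form (hQ.single x) (hQ.single y) = -G.b x y := by
  have h1 : (hQ.single x).1.1 y = 0 := ell2Single_of_ne m h.symm
  have h2 : (hQ.single x).1.1 x = 1 := ell2Single_self m x
  rw [hQ.form_single hm, h1, tsum_eq_single x, h2, G.b_symm x y]
  · ring
  · intro z hz
    have h3 : (hQ.single x).1.1 z = 0 := ell2Single_of_ne m hz
    rw [h3, sub_zero, mul_zero]

theorem AssociatedTo.form_single_self (hQ : Q.AssociatedTo G) (hm : ∀ x, m x = 1) (x : X) :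
    Q.form (hQ.single x) (hQ.single x) = ∑' z, G.b x z + G.c x := by
  have h2 : (hQ.single x).1.1 x = 1 := ell2Single_self m x
  rw [hQ.form_single hm, h2, mul_one]
  congr 1
  refine tsum_congr fun z => ?_
  by_cases hz : z = x
  · simp [hz, G.b_diag]
  · have h3 : (hQ.single x).1.1 z = 0 := ell2Single_of_ne m hz
    rw [h3, sub_zero, mul_one]

/-- The resolvent kernel is positive along edges. -/
theorem DirichletAssociatedTo.resolvent_single_pos (hQ : Q.DirichletAssociatedTo G)
    (hm : ∀ x, m x = 1) {x y : X} (hxy : 0 < G.b x y) {u : Q.domain}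
    (hu : Q.IsResolvent u (ell2Single m y)) : 0 < u.1.1 x := by
  have hm' : ∀ x, 0 < m x := fun x => by rw [hm]; exact one_pos
  have hnonneg := hQ.resolvent_nonneg hm' hu (ell2Single_nonneg m y)
  refine (hnonneg x).lt_of_ne' fun hx => ?_
  have hne : x ≠ y := by
    rintro rfl
    exact hxy.ne' (G.b_diag x)
  -- If `u` vanishes at `x`, the equation at `x` reads `∑ b(x, z) u(z) = 0` with non-negative terms,
  -- so `u` also vanishes at the neighbour `y`.
  have h := hu (hQ.single x)
  rw [Q.shifted_apply, hQ.form_single hm] at h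
  change _ + ell2Inner u.1 (ell2Single m x) = ell2Inner (ell2Single m y) (ell2Single m x) at h
  rw [ell2Inner_single, ell2Inner_single, ell2Single_of_ne m hne, hx, mul_zero, zero_mul, add_zero,
    add_zero] at h
  have hsum := G.summable_mul_sub hm u.1 x
  rw [hx] at hsum
  have hz := (hsum.hasSum_iff.2 h).neg
  rw [neg_zero, hasSum_zero_iff_of_nonneg] at hz
  · have hy := congrFun hz y
    have huy : u.1.1 y = 0 := by simpa [hxy.ne'] using hy
    -- The squared form norm of `u` is `⟨1_y, u⟩ = u(y) = 0`; then `u = 0` contradicts the equation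
    -- at `y`.
    have hu0 : u = 0 := Q.eq_zero_of_shifted_self hm' u (by
      rw [hu u, ell2Inner_comm, ell2Inner_single, huy, zero_mul])
    have h1 := hu (hQ.single y)
    change _ = ell2Inner (ell2Single m y) (ell2Single m y) at h1
    rw [hu0, map_zero, LinearMap.zero_apply, ell2Inner_single, ell2Single_self, hm] at h1
    norm_num at h1
  · intro z
    have := mul_nonneg (G.b_nonneg x z) (hnonneg z)
    change 0 ≤ -(G.b x z * (0 - u.1.1 z))
    linarith

end NonnegForm

end GraphDiffusion
-- Structure of order isomorphisms
namespace GraphDiffusion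

section OrderIsomorphism

variable {X₁ X₂ : Type*} {m₁ : X₁ → ℝ} {m₂ : X₂ → ℝ} {U : ell2 m₁ ≃ₗ[ℝ] ell2 m₂}

theorem IsOrderIsomorphism.symm (hU : IsOrderIsomorphism U) : IsOrderIsomorphism U.symm :=
  ⟨hU.2, fun f hf => by simpa using hU.1 f hf⟩

theorem IsOrderIsomorphism.mono (hU : IsOrderIsomorphism U) {f g : ell2 m₁}
    (h : ∀ x, f.1 x ≤ g.1 x) (y : X₂) : (U f).1 y ≤ (U g).1 y := by
  have h0 := hU.1 (g - f) (fun x => sub_nonneg.2 (h x)) y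
  rw [map_sub U g f] at h0
  exact sub_nonneg.1 h0

/-- Order isomorphisms map atoms to atoms. -/
theorem IsOrderIsomorphism.exists_apply_single (hU : IsOrderIsomorphism U) (x : X₁) :
    ∃ (y : X₂) (a : ℝ), 0 < a ∧ U (ell2Single m₁ x) = a • ell2Single m₂ y := by
  have hnonneg := hU.1 _ (ell2Single_nonneg m₁ x)
  obtain ⟨y, hy⟩ : ∃ y, (U (ell2Single m₁ x)).1 y ≠ 0 := by
    by_contra! h
    have h0 : U (ell2Single m₁ x) = 0 := Subtype.ext (funext h)
    have h1 : ell2Single m₁ x = 0 := by simpa using h0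
    have h2 := ell2Single_self m₁ x
    rw [h1] at h2
    exact zero_ne_one h2
  set a := (U (ell2Single m₁ x)).1 y with ha
  have hapos : 0 < a := (hnonneg y).lt_of_ne' hy
  have hle : ∀ z, (a • ell2Single m₂ y).1 z ≤ (U (ell2Single m₁ x)).1 z := by
    intro z
    by_cases hz : z = y
    · subst hz
      simp [ha]
    · simpa [ell2Single_of_ne m₂ hz] using hnonneg z
  -- Pulling back `0 ≤ a • 1_y ≤ U 1_x` puts `g` between `0` and `1_x`, so `g` is a multiple of
  -- `1_x`.
  set g := U.symm (a • ell2Single m₂ y) with hg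
  have hg1 : ∀ z, g.1 z ≤ (ell2Single m₁ x).1 z := by
    intro z
    have h := hU.symm.mono hle z
    rwa [U.symm_apply_apply] at h
  have hg0 : ∀ z, 0 ≤ g.1 z := hU.2 _ fun z =>
    mul_nonneg hapos.le (ell2Single_nonneg m₂ y z)
  have hgx : g = g.1 x • ell2Single m₁ x := by
    refine Subtype.ext (funext fun z => ?_)
    by_cases hz : z = x
    · subst hz
      simp
    · have h := hg1 z
      rw [ell2Single_of_ne m₁ hz] at h
      simpa [ell2Single_of_ne m₁ hz] using le_antisymm h (hg0 z)
  have hUg : a • ell2Single m₂ y = g.1 x • U (ell2Single m₁ x) := by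
    rw [← map_smul, ← hgx, hg, U.apply_symm_apply]
  have hval := congrArg (fun f : ell2 m₂ => f.1 y) hUg
  simp only [Submodule.coe_smul, Pi.smul_apply, ell2Single_self, smul_eq_mul, mul_one] at hval
  rw [← ha] at hval
  have hone : g.1 x = 1 := mul_right_cancel₀ hapos.ne' (by rw [one_mul]; exact hval.symm)
  exact ⟨y, a, hapos, by rw [hUg, hone, one_smul]⟩

theorem smul_ell2Single_injective {X : Type*} {m : X → ℝ} {x y : X} {a : ℝ}
    (h : ell2Single m x = a • ell2Single m y) : x = y := by
  by_contra hne
  have h1 := congrArg (fun f : ell2 m => f.1 x) h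
  simp [ell2Single_of_ne m hne] at h1

theorem IsOrderIsomorphism.exists_isScalingAndBijection (hU : IsOrderIsomorphism U) :
    ∃ (h : X₂ → ℝ) (τ : X₂ → X₁), IsScalingAndBijection U h τ := by
  choose σ a ha hσ using hU.exists_apply_single
  choose τ b hb hτ using hU.symm.exists_apply_single
  have hτσ : ∀ x, τ (σ x) = x := fun x => by
    have h := congrArg U.symm (hσ x)
    rw [U.symm_apply_apply, map_smul, hτ, smul_smul] at h
    exact (smul_ell2Single_injective h).symm
  have hστ : ∀ y, σ (τ y) = y := fun y => by
    have h := congrArg U (hτ y)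
    rw [U.apply_symm_apply, map_smul, hσ, smul_smul] at h
    exact (smul_ell2Single_injective h).symm
  -- Otherwise a positive multiple of `1_y` lies below `U f`, and its preimage, a positive multiple
  -- of `1_{τ y}`, lies below `f`.
  have hvanish : ∀ (f : ell2 m₁) (y : X₂), (∀ x, 0 ≤ f.1 x) → f.1 (τ y) = 0 → (U f).1 y = 0 := by
    intro f y hf hfy
    have hUf := hU.1 f hf
    refine le_antisymm (not_lt.1 fun hpos => ?_) (hUf y)
    have hle : ∀ z, ((U f).1 y • ell2Single m₂ y).1 z ≤ (U f).1 z := by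
      intro z
      by_cases hz : z = y
      · subst hz
        simp
      · simpa [ell2Single_of_ne m₂ hz] using hUf z
    have h := hU.symm.mono hle (τ y)
    rw [U.symm_apply_apply, hfy, map_smul, hτ] at h
    simp only [Submodule.coe_smul, Pi.smul_apply, ell2Single_self, smul_eq_mul, mul_one] at h
    exact (mul_pos hpos (hb y)).not_ge h
  have hvanish' : ∀ (f : ell2 m₁) (y : X₂), f.1 (τ y) = 0 → (U f).1 y = 0 := by
    intro f y hfy
    let g : ell2 m₁ := ⟨fun x => |f.1 x|, by
      change Summable fun x => |f.1 x| ^ 2 * m₁ x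
      simp only [sq_abs]
      exact f.2⟩
    have hg : (U g).1 y = 0 := hvanish g y (fun x => abs_nonneg _) (by simp [g, hfy])
    have h1 : (U f).1 y ≤ (U g).1 y := hU.mono (fun x => le_abs_self _) y
    have h2 : (U (-f)).1 y ≤ (U g).1 y := hU.mono (fun x => neg_le_abs _) y
    rw [map_neg] at h2
    change -(U f).1 y ≤ _ at h2
    linarith
  refine ⟨fun y => a (τ y), τ, fun y => ha _, ⟨fun y z h => ?_, fun x => ⟨σ x, hτσ x⟩⟩,
    fun f y => ?_⟩
  · rw [← hστ y, h, hστ]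
  -- Removing the atom at `τ y` reduces to a function vanishing there, so neither continuity of `U`
  -- nor an expansion into atoms is needed.
  · have h := hvanish' (f - f.1 (τ y) • ell2Single m₁ (τ y)) y (by simp)
    rw [map_sub U, map_smul, hσ, hστ] at h
    have h' : (U f).1 y - f.1 (τ y) * (a (τ y) * (ell2Single m₂ y).1 y) = 0 := h
    rw [ell2Single_self] at h'
    linarith

namespace IsScalingAndBijection

variable {h : X₂ → ℝ} {τ : X₂ → X₁}

theorem apply_single (hS : IsScalingAndBijection U h τ) (y : X₂) :
    U (ell2Single m₁ (τ y)) = h y • ell2Single m₂ y := by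
  refine Subtype.ext (funext fun z => ?_)
  rw [hS.apply_eq]
  by_cases hz : z = y
  · subst hz
    simp
  · simp [ell2Single_of_ne m₂ hz, ell2Single_of_ne m₁ (hS.bijective.injective.ne hz)]

theorem unique {h' : X₂ → ℝ} {τ' : X₂ → X₁} (hS : IsScalingAndBijection U h τ)
    (hS' : IsScalingAndBijection U h' τ') : h' = h ∧ τ' = τ := by
  have key : ∀ y, h y = h' y * (ell2Single m₁ (τ y)).1 (τ' y) := fun y => by
    rw [← hS'.apply_eq, hS.apply_single]
    simp
  have hτ : ∀ y, τ' y = τ y := fun y => by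
    by_contra hne
    have := key y
    rw [ell2Single_of_ne m₁ hne, mul_zero] at this
    exact (hS.pos y).ne' this
  refine ⟨funext fun y => ?_, funext hτ⟩
  rw [key y, hτ, ell2Single_self, mul_one]

end IsScalingAndBijection

end OrderIsomorphism

end GraphDiffusion
-- Intertwining of resolvents and forms
namespace GraphDiffusion

section Intertwining

variable {X₁ X₂ : Type*} {m₁ : X₁ → ℝ} {m₂ : X₂ → ℝ} {U : ell2 m₁ ≃ₗ[ℝ] ell2 m₂}

theorem Intertwines.symm {L₁ : ell2 m₁ →ₗ.[ℝ] ell2 m₁} {L₂ : ell2 m₂ →ₗ.[ℝ] ell2 m₂}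
    (hU : Intertwines U L₁ L₂) : Intertwines U.symm L₂ L₁ := by
  refine ⟨?_, fun g f hfg => ?_⟩
  · rw [← hU.1, ← Set.image_comp]
    simp
  · rw [LinearEquiv.symm_apply_eq, hU.2 f g (by rw [hfg, U.apply_symm_apply])]

variable {G₁ : WeightedGraph X₁} {G₂ : WeightedGraph X₂} {Q₁ : NonnegForm m₁} {Q₂ : NonnegForm m₂}

/-- Translates between the unbounded operator and the weak resolvent equation. -/
theorem NonnegForm.AssociatedTo.exists_apply_eq_iff_isResolvent {X : Type*} {m : X → ℝ}
    {G : WeightedGraph X} {Q : NonnegForm m} (hQ : Q.AssociatedTo G) (hm : ∀ x, 0 < m x)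
    {u w : ell2 m} :
    (∃ f : Q.laplacian.domain, f.1 = u ∧ Q.laplacian f = w - u) ↔
      ∃ u' : Q.domain, u'.1 = u ∧ Q.IsResolvent u' w := by
  rw [← sub_add_cancel w u]
  simp only [NonnegForm.IsResolvent]
  rw [← NonnegForm.mem_generatorGraph_iff, ← hQ.laplacian_graph hm, LinearPMap.mem_graph_iff,
    add_sub_cancel_right]

theorem Intertwines.exists_isResolvent (hint : Intertwines U Q₁.laplacian Q₂.laplacian)
    (hQ₁ : Q₁.AssociatedTo G₁) (hQ₂ : Q₂.AssociatedTo G₂) (hm₁ : ∀ x, 0 < m₁ x)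
    (hm₂ : ∀ x, 0 < m₂ x) {u : Q₁.domain} {w : ell2 m₁} (hu : Q₁.IsResolvent u w) :
    ∃ u' : Q₂.domain, u'.1 = U u.1 ∧ Q₂.IsResolvent u' (U w) := by
  obtain ⟨f, hf, hLf⟩ := (hQ₁.exists_apply_eq_iff_isResolvent hm₁).2 ⟨u, rfl, hu⟩
  have hmem : U f.1 ∈ (Q₂.laplacian.domain : Set (ell2 m₂)) := by
    rw [← hint.1]
    exact ⟨f.1, f.2, rfl⟩
  refine (hQ₂.exists_apply_eq_iff_isResolvent hm₂).1 ⟨⟨U f.1, hmem⟩, congrArg U hf, ?_⟩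
  rw [← hint.2 f ⟨U f.1, hmem⟩ rfl, hLf, map_sub U w u.1]

/-- A multiple of a unitary intertwining the generators maps the forms onto each other. -/
theorem Intertwines.mul_shifted_le (hint : Intertwines U Q₁.laplacian Q₂.laplacian)
    (hQ₁ : Q₁.AssociatedTo G₁) (hQ₂ : Q₂.AssociatedTo G₂) (hm₁ : ∀ x, 0 < m₁ x)
    (hm₂ : ∀ x, 0 < m₂ x) {K : ℝ} (hK : 0 < K)
    (hinner : ∀ f g, ell2Inner (U f) (U g) = K * ell2Inner f g)
    {f₁ : Q₁.domain} {f₂ : Q₂.domain} (hf : f₂.1 = U f₁.1) :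
    K * Q₁.shifted f₁ f₁ ≤ Q₂.shifted f₂ f₂ := by
  refine le_of_forall_pos_le_add fun ε hε => ?_
  obtain ⟨u, w, hu, hfu⟩ := hQ₁.closed.exists_resolvent_approx hm₁ f₁ (div_pos hε hK)
  obtain ⟨u', hu', hres⟩ := hint.exists_isResolvent hQ₁ hQ₂ hm₁ hm₂ hu
  -- Expanding the square bounds the form at `f₂` below by `2⟨U w, U f₁⟩ - ⟨U w, U u⟩`. This is `K
  -- (2⟨w, f₁⟩ - ⟨w, u⟩)`, which is within `ε` of `K` times the form at `f₁`.
  have h₂ := Q₂.shifted_nonneg hm₂ (f₂ - u')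
  rw [Q₂.shifted_sub_self, hres, hres, hf, hu', hinner, hinner] at h₂
  rw [Q₁.shifted_sub_self, hu, hu, lt_div_iff₀' hK] at hfu
  linarith

/-- Equality on the diagonal comes from the inequality for `U` with `K` and for `U.symm` with `K⁻¹`;
polarization does the rest. -/
theorem Intertwines.shifted_eq (hint : Intertwines U Q₁.laplacian Q₂.laplacian)
    (hQ₁ : Q₁.AssociatedTo G₁) (hQ₂ : Q₂.AssociatedTo G₂) (hm₁ : ∀ x, 0 < m₁ x)
    (hm₂ : ∀ x, 0 < m₂ x) {K : ℝ} (hK : 0 < K)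
    (hinner : ∀ f g, ell2Inner (U f) (U g) = K * ell2Inner f g)
    {f₁ g₁ : Q₁.domain} {f₂ g₂ : Q₂.domain} (hf : f₂.1 = U f₁.1) (hg : g₂.1 = U g₁.1) :
    Q₂.shifted f₂ g₂ = K * Q₁.shifted f₁ g₁ := by
  have key : ∀ {f₁ : Q₁.domain} {f₂ : Q₂.domain}, f₂.1 = U f₁.1 →
      Q₂.shifted f₂ f₂ = K * Q₁.shifted f₁ f₁ := by
    intro f₁ f₂ hf
    refine le_antisymm ?_ (hint.mul_shifted_le hQ₁ hQ₂ hm₁ hm₂ hK hinner hf)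
    have h := hint.symm.mul_shifted_le hQ₂ hQ₁ hm₂ hm₁ (inv_pos.2 hK) (fun f g => by
      rw [eq_inv_mul_iff_mul_eq₀ hK.ne', ← hinner, U.apply_symm_apply, U.apply_symm_apply])
      (f₁ := f₂) (f₂ := f₁) (by rw [hf, U.symm_apply_apply])
    rwa [inv_mul_le_iff₀ hK] at h
  have hsub : (f₂ - g₂).1 = U (f₁ - g₁).1 := by
    change f₂.1 - g₂.1 = U (f₁.1 - g₁.1)
    rw [map_sub U f₁.1 g₁.1, hf, hg]
  have h := key hsub
  rw [Q₁.shifted_sub_self, Q₂.shifted_sub_self, key hf, key hg, Q₁.shifted_comm g₁ f₁,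
    Q₂.shifted_comm g₂ f₂] at h
  linear_combination -(1 / 2) * h

end Intertwining

/-! ### Constancy of the scaling and recovery of the graph -/

section Counting

variable {X₁ X₂ : Type*} {m₁ : X₁ → ℝ} {m₂ : X₂ → ℝ} {U : ell2 m₁ ≃ₗ[ℝ] ell2 m₂}
  {G₁ : WeightedGraph X₁} {G₂ : WeightedGraph X₂} {Q₁ : NonnegForm m₁} {Q₂ : NonnegForm m₂}
  {h : X₂ → ℝ} {τ : X₂ → X₁}

theorem IsScalingAndBijection.scaling_eq_of_edge (hS : IsScalingAndBijection U h τ)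
    (hint : Intertwines U Q₁.laplacian Q₂.laplacian) (hm₁ : ∀ x, m₁ x = 1) (hm₂ : ∀ y, m₂ y = 1)
    (hQ₁ : Q₁.DirichletAssociatedTo G₁) (hQ₂ : Q₂.AssociatedTo G₂) {y z : X₂}
    (hyz : 0 < G₁.b (τ y) (τ z)) : h y = h z := by
  have hm₁' : ∀ x, 0 < m₁ x := fun x => by rw [hm₁]; exact one_pos
  have hm₂' : ∀ x, 0 < m₂ x := fun x => by rw [hm₂]; exact one_pos
  obtain ⟨uy, huy⟩ := hQ₁.closed.exists_resolvent hm₁' (ell2Single m₁ (τ y))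
  obtain ⟨uz, huz⟩ := hQ₁.closed.exists_resolvent hm₁' (ell2Single m₁ (τ z))
  have hpos := hQ₁.resolvent_single_pos hm₁ hyz huz
  obtain ⟨vy, hvy, hresy⟩ := hint.exists_isResolvent hQ₁.toAssociatedTo hQ₂ hm₁' hm₂' huy
  obtain ⟨vz, hvz, hresz⟩ := hint.exists_isResolvent hQ₁.toAssociatedTo hQ₂ hm₁' hm₂' huz
  have hG₁ := NonnegForm.IsResolvent.inner_comm huy huz
  have hG₂ := hresy.inner_comm hresz
  rw [ell2Inner_comm, ell2Inner_single, ell2Inner_comm, ell2Inner_single, hm₁, hm₁] at hG₁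
  rw [hS.apply_single, hS.apply_single, ell2Inner_smul_left, ell2Inner_smul_left, ell2Inner_comm,
    ell2Inner_single, ell2Inner_comm, ell2Inner_single, hm₂, hm₂, hvy, hvz, hS.apply_eq,
    hS.apply_eq] at hG₂
  rw [mul_one, mul_one] at hG₁
  rw [← hG₁] at hG₂
  -- One factor of `h` comes from the source `U 1_{τ y} = h(y) 1_y`, the other from evaluating `U`
  -- at `y`.
  have hsq : h y ^ 2 = h z ^ 2 := mul_right_cancel₀ hpos.ne' (by linear_combination hG₂)
  exact (pow_left_inj₀ (hS.pos y).le (hS.pos z).le two_ne_zero).1 hsq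

theorem WeightedGraph.Connected.eq_of_edge {X α : Type*} {G : WeightedGraph X} (hG : G.Connected)
    {k : X → α} (hk : ∀ x y, 0 < G.b x y → k x = k y) (x y : X) : k x = k y := by
  obtain ⟨n, p, -, h0, hn, hp⟩ := hG x y
  have key : ∀ i : Fin (n + 1), k (p 0) = k (p i) := fun i =>
    Fin.induction rfl (fun i hi => hi.trans (hk _ _ (hp i))) i
  rw [← h0, ← hn]
  exact key _

theorem IsScalingAndBijection.scaling_eq (hS : IsScalingAndBijection U h τ)
    (hint : Intertwines U Q₁.laplacian Q₂.laplacian) (hm₁ : ∀ x, m₁ x = 1) (hm₂ : ∀ y, m₂ y = 1)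
    (hQ₁ : Q₁.DirichletAssociatedTo G₁) (hQ₂ : Q₂.AssociatedTo G₂) (hconn : G₁.Connected)
    (y z : X₂) : h y = h z := by
  let e := Equiv.ofBijective τ hS.bijective
  have hτ : ∀ x, τ (e.symm x) = x := e.apply_symm_apply
  have key := hconn.eq_of_edge (k := fun x => h (e.symm x)) (fun x x' hx =>
    hS.scaling_eq_of_edge hint hm₁ hm₂ hQ₁ hQ₂ (by rwa [hτ, hτ])) (e y) (e z)
  simpa using key

theorem IsScalingAndBijection.form_single_eq (hS : IsScalingAndBijection U h τ)
    (hint : Intertwines U Q₁.laplacian Q₂.laplacian) (hm₁ : ∀ x, m₁ x = 1) (hm₂ : ∀ y, m₂ y = 1)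
    (hQ₁ : Q₁.DirichletAssociatedTo G₁) (hQ₂ : Q₂.AssociatedTo G₂) (hconn : G₁.Connected)
    (y z : X₂) : Q₂.form (hQ₂.single y) (hQ₂.single z) =
      Q₁.form (hQ₁.single (τ y)) (hQ₁.single (τ z)) := by
  have hm₁' : ∀ x, 0 < m₁ x := fun x => by rw [hm₁]; exact one_pos
  have hm₂' : ∀ x, 0 < m₂ x := fun x => by rw [hm₂]; exact one_pos
  have hc := hS.pos y
  have hconst : ∀ z, h z = h y := fun z => hS.scaling_eq hint hm₁ hm₂ hQ₁ hQ₂ hconn z y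
  have hinner : ∀ f g, ell2Inner (U f) (U g) = h y ^ 2 * ell2Inner f g := by
    intro f g
    unfold ell2Inner
    rw [← (Equiv.ofBijective τ hS.bijective).tsum_eq, ← tsum_mul_left]
    refine tsum_congr fun z => ?_
    rw [hS.apply_eq, hS.apply_eq, hconst z, hm₁, hm₂, Equiv.ofBijective_apply]
    ring
  have hsingle : ∀ z, (h y • hQ₂.single z).1 = U (hQ₁.single (τ z)).1 := fun z => by
    change h y • ell2Single m₂ z = U (ell2Single m₁ (τ z))
    rw [hS.apply_single, hconst z]
  have key := hint.shifted_eq hQ₁.toAssociatedTo hQ₂ hm₁' hm₂' (pow_pos hc 2) hinner (hsingle y)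
    (hsingle z)
  have hin := hinner (hQ₁.single (τ y)).1 (hQ₁.single (τ z)).1
  rw [← hsingle, ← hsingle] at hin
  rw [NonnegForm.shifted_apply, NonnegForm.shifted_apply, mul_add, hin, add_left_inj, map_smul,
    map_smul, LinearMap.smul_apply, smul_eq_mul, smul_eq_mul, ← mul_assoc, ← sq] at key
  exact mul_left_cancel₀ (pow_pos hc 2).ne' key

theorem IsScalingAndBijection.graph_eq (hS : IsScalingAndBijection U h τ)
    (hint : Intertwines U Q₁.laplacian Q₂.laplacian) (hm₁ : ∀ x, m₁ x = 1) (hm₂ : ∀ y, m₂ y = 1)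
    (hQ₁ : Q₁.DirichletAssociatedTo G₁) (hQ₂ : Q₂.AssociatedTo G₂) (hconn : G₁.Connected) :
    (∀ y z, G₁.b (τ y) (τ z) = G₂.b y z) ∧ ∀ y, G₁.c (τ y) = G₂.c y := by
  have hform := hS.form_single_eq hint hm₁ hm₂ hQ₁ hQ₂ hconn
  have hb : ∀ y z, G₁.b (τ y) (τ z) = G₂.b y z := by
    intro y z
    by_cases hyz : y = z
    · rw [hyz, G₁.b_diag, G₂.b_diag]
    · have key := hform y z
      rw [hQ₂.form_single_of_ne hm₂ hyz, hQ₁.form_single_of_ne hm₁ (hS.bijective.injective.ne hyz)]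
        at key
      exact (neg_injective key).symm
  refine ⟨hb, fun y => ?_⟩
  -- The row sums of `b` correspond under `τ` by `hb`, so the diagonal values differ only in the
  -- killing terms.
  have key := hform y y
  rw [hQ₂.form_single_self hm₂, hQ₁.form_single_self hm₁,
    ← (Equiv.ofBijective τ hS.bijective).tsum_eq] at key
  simp only [Equiv.ofBijective_apply, hb] at key
  exact (add_left_cancel key).symm

end Counting

end GraphDiffusion

theorem theorem9p1 {X₁ : Type*} {X₂ : Type*} [Countable X₁] [Countable X₂]
    (m₁ : X₁ → ℝ) (m₂ : X₂ → ℝ) (hm₁ : ∀ x, m₁ x = 1) (hm₂ : ∀ y, m₂ y = 1)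
    (G₁ : GraphDiffusion.WeightedGraph X₁) (G₂ : GraphDiffusion.WeightedGraph X₂)
    (hconn : G₁.Connected)
    (Q₁ : GraphDiffusion.NonnegForm m₁) (Q₂ : GraphDiffusion.NonnegForm m₂)
    (hQ₁ : Q₁.DirichletAssociatedTo G₁) (hQ₂ : Q₂.DirichletAssociatedTo G₂)
    (U : GraphDiffusion.ell2 m₁ ≃ₗ[ℝ] GraphDiffusion.ell2 m₂)
    (hU : GraphDiffusion.IsOrderIsomorphism U)
    (hint : GraphDiffusion.Intertwines U Q₁.laplacian Q₂.laplacian) :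
    (∃! p : (X₂ → ℝ) × (X₂ → X₁), GraphDiffusion.IsScalingAndBijection U p.1 p.2) ∧
      ∀ (h : X₂ → ℝ) (τ : X₂ → X₁), GraphDiffusion.IsScalingAndBijection U h τ →
        (∀ y z, G₁.b (τ y) (τ z) = G₂.b y z) ∧ ∀ y, G₁.c (τ y) = G₂.c y := by
  obtain ⟨h, τ, hS⟩ := hU.exists_isScalingAndBijection
  exact ⟨⟨(h, τ), hS, fun p hp => Prod.ext (hS.unique hp).1 (hS.unique hp).2⟩,
    fun h τ hS => hS.graph_eq hint hm₁ hm₂ hQ₁ hQ₂.toAssociatedTo hconn⟩
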